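/- **Corollary 4.5 (simplex Descartes).** Let $d\ge 1$. *Setting.* On $\mathbb R^{d+2}$ let $\langle x,y\rangle=x_1y_1+\dots+x_{d+1}y_{d+1}-x_{d+2}y_{d+2}$. A $d$-ball of $\widehat{\mathbb R}^d=\mathbb R^d\cup\{\infty\}$ is a closed ball of radius $r$ (curvature $1/r$), the exterior of an open ball of radius $r$ together with $\infty$ (curvature $-1/r$), or a closed half-space together with $\infty$ (curvature $0$). Its Lorentzian vector is $\frac{\kappa}{2}(2c,\|c\|^2-\kappa^{-2}-1,\|c\|^2-\kappa^{-2}+1)$ if it has center $c$ and curvature $\kappa\ne0$, and $(n,\delta,\delta)$ if it is the half-space $\{x : n\cdot x\ge\delta\}$ with $\|n\|=1$. For $u\in\mathbb R^{d+1}$ with $\|u\|>1$, let $b(u)$ be the $d$-ball illuminated from $u$, that is, the image under the stereographic projection from the north pole $e_{d+1}$ of the cap $\{p\in\mathbb S^d : u\cdot p\ge1\}$; its Lorentzian vector is $\mathbf x_{b(u)}=(\|u\|^2-1)^{-1/2}(u,1)$. For a polytope $P\subset\mathbb R^{d+1}$ all of whose vertices have norm $>1$, with vertex set $V(P)$, put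 $$\mathbf x_P=\frac1{|V(P)|}\sum_{v\in V(P)}\mathbf x_{b(v)},\qquad \kappa_P=-\langle e_{d+1}+e_{d+2},\mathbf x_P\rangle,$$ which is the average of the curvatures of the balls $b(v)$, $v\in V(P)$ (the Lorentzian curvature of $P$). A polytope is edge-scribed if each of its edges is tangent to the unit sphere, that is, touches the sphere and spans a line that does not meet the open unit ball. A flag of a $(d+1)$-polytope $P$ is a chain $f_0\subset f_1\subset\dots\subset f_{d+1}=P$ with $f_i$ an $i$-dimensional face of $P$. *Statement.* (a) Let $T\subset\mathbb R^{d+1}$ be an edge-scribed $(d+1)$-simplex and $(f_0,\dots,f_d,f_{d+1}=T)$ any flag of $T$. Then all vertices of $T$ have norm $>1$ and $$\kappa_T^2=\frac{d}{d+2}\sum_{i=0}^{d}\binom{i+2}{2}\bigl(\kappa_{f_i}-\kappa_{f_{i+1}}\bigr)^2 .$$ (b) In the situation of (a), the vertices of $T$ can be labelled $v_1,\dots,v_{d+2}$ so that, for $0\le i\le d+1$, the vertices of $f_i$ are $v_1,\dots,v_{i+1}$. With $\kappa_j$ the curvature of $b(v_j)$, $$\kappa_{f_i}=\frac{1}{i+1}(\kappa_1+\dots+\kappa_{i+1})\quad(0\le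 i\le d+1),\qquad (\kappa_1+\dots+\kappa_{d+2})^2=d\,(\kappa_1^2+\dots+\kappa_{d+2}^2).$$ (c) (Soddy–Gosset) If $b_1,\dots,b_{d+2}$ are $d$-balls of $\widehat{\mathbb R}^d$ that are pairwise externally tangent (any two have exactly one point of $\widehat{\mathbb R}^d$ in common) and $\kappa_j$ is the curvature of $b_j$, then $$(\kappa_1+\dots+\kappa_{d+2})^2=d\,(\kappa_1^2+\dots+\kappa_{d+2}^2).$$ -/

import Mathlib

open scoped BigOperators

noncomputable section

namespace PolytopalBalls

/-- The Euclidean space of dimension `n`. -/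
abbrev Euc (n : ℕ) : Type := EuclideanSpace ℝ (Fin n)

/-! ## Lorentzian space -/

/-- The vector space underlying the Lorentzian space of signature `(d+1, 1)`, of dimension `d+2`.
Index `Fin.last (d+1)` is the time coordinate. -/
abbrev LorentzSpace (d : ℕ) : Type := Fin (d + 2) → ℝ

/-- The Lorentzian product `x₁y₁ + ⋯ + x_{d+1}y_{d+1} - x_{d+2}y_{d+2}`. -/
def lorentzProd {d : ℕ} (x y : LorentzSpace d) : ℝ :=
  (∑ i : Fin (d + 1), x i.castSucc * y i.castSucc) - x (Fin.last (d + 1)) * y (Fin.last (d + 1))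

/-- The light-like vector `x_N = e_{d+1} + e_{d+2}`. -/
def northVec (d : ℕ) : LorentzSpace d :=
  Pi.single (Fin.last d).castSucc 1 + Pi.single (Fin.last (d + 1)) 1

/-- The curvature `κ(x) = -⟨x_N, x⟩` of a vector of the Lorentzian space. -/
def vecCurvature {d : ℕ} (x : LorentzSpace d) : ℝ := -lorentzProd (northVec d) x

/-! ## The `d`-balls of `ℝ^d ∪ {∞}` -/

/-- A `d`-ball of `ℝ^d ∪ {∞}`: either bounded by a sphere, with given center and nonzero signed
curvature, or a half-space, with given unit normal pointing to the interior and signed distance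
from its boundary to the origin. -/
inductive Ball (d : ℕ) : Type
  | round (c : Euc d) (k : ℝ) (hk : k ≠ 0) : Ball d
  | half (n : Euc d) (δ : ℝ) (hn : ‖n‖ = 1) : Ball d

namespace Ball

variable {d : ℕ}

/-- The signed curvature: `1/r` for a closed ball of radius `r`, `-1/r` for the exterior of an
open ball of radius `r`, and `0` for a half-space. -/
def curvature : Ball d → ℝ
  | round _ k _ => k
  | half _ _ _ => 0

/-- The points of `ℝ^d ∪ {∞}` in the ball: a closed ball of radius `1/k` if `k > 0`, the exterior
of an open ball of radius `-1/k`, with `∞`, if `k < 0`, a closed half-space with `∞` if the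
curvature is zero. -/
def carrier : Ball d → Set (OnePoint (Euc d))
  | round c k _ =>
      {z | (0 < k ∧ ∃ x : Euc d, z = (x : OnePoint (Euc d)) ∧ ‖x - c‖ ≤ 1 / k) ∨
        (k < 0 ∧ (z = OnePoint.infty ∨
          ∃ x : Euc d, z = (x : OnePoint (Euc d)) ∧ -(1 / k) ≤ ‖x - c‖))}
  | half n δ _ =>
      {z | z = OnePoint.infty ∨
        ∃ x : Euc d, z = (x : OnePoint (Euc d)) ∧ δ ≤ inner ℝ n x}

/-- Two balls are (externally) tangent when they have exactly one point of `ℝ^d ∪ {∞}` in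
common. -/
def Tangent (b b' : Ball d) : Prop := ∃ z, b.carrier ∩ b'.carrier = {z}

/-- The Lorentzian vector of a ball, given by its inversive coordinates. -/
def lorentzVec : Ball d → LorentzSpace d
  | round c k _ =>
      (k / 2) • (Fin.snoc (α := fun _ => ℝ)
        (Fin.snoc (α := fun _ => ℝ) (fun i => 2 * c i) (‖c‖ ^ 2 - (k ^ 2)⁻¹ - 1))
        (‖c‖ ^ 2 - (k ^ 2)⁻¹ + 1) : LorentzSpace d)
  | half n δ _ =>
      Fin.snoc (α := fun _ => ℝ) (Fin.snoc (α := fun _ => ℝ) (fun i => n i) δ) δ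

end Ball

/-- The curvature of a ball is that of its Lorentzian vector. -/
theorem vecCurvature_lorentzVec {d : ℕ} (b : Ball d) : vecCurvature b.lorentzVec = b.curvature := by
  have h : ∀ x : LorentzSpace d,
      vecCurvature x = x (Fin.last (d + 1)) - x (Fin.last d).castSucc := by
    intro x
    have h1 : ∀ i : Fin (d + 1), northVec d i.castSucc = if i = Fin.last d then 1 else 0 := by
      intro i
      simp [northVec, Pi.single_apply]
    have h2 : northVec d (Fin.last (d + 1)) = 1 := by
      simp [northVec, Pi.single_apply, Fin.ext_iff]
    simp [vecCurvature, lorentzProd, h1, h2]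
  rw [h]
  cases b with
  | round c k hk =>
    simp [Ball.lorentzVec, Ball.curvature]
    ring
  | half n δ hn => simp [Ball.lorentzVec, Ball.curvature]

/-! ## Light sources -/

/-- The first `d` coordinates of a point of the Euclidean space of dimension `d + 1`. -/
def horiz {d : ℕ} (u : Euc (d + 1)) : Euc d := WithLp.toLp 2 fun i => u i.castSucc

/-- The inverse of the stereographic projection from the north pole `e_{d+1}`, from `ℝ^d ∪ {∞}` to
the unit sphere of the Euclidean space of dimension `d + 1`. -/
def invStereo {d : ℕ} : OnePoint (Euc d) → Euc (d + 1)
  | none => WithLp.toLp 2 (Fin.snoc (α := fun _ => ℝ) (fun _ => 0) 1)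
  | some x => (‖x‖ ^ 2 + 1)⁻¹ •
      WithLp.toLp 2 (Fin.snoc (α := fun _ => ℝ) (fun i => 2 * x i) (‖x‖ ^ 2 - 1))

theorem norm_sq_eq_horiz {d : ℕ} (u : Euc (d + 1)) :
    ‖u‖ ^ 2 = ‖horiz u‖ ^ 2 + u (Fin.last d) ^ 2 := by
  simp [EuclideanSpace.norm_sq_eq, Fin.sum_univ_castSucc, horiz]

theorem horiz_norm_pos {d : ℕ} {u : Euc (d + 1)} (hu : 1 < ‖u‖) (h : u (Fin.last d) = 1) :
    0 < ‖horiz u‖ := by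
  have h1 := norm_sq_eq_horiz u
  rw [h] at h1
  have h2 := norm_nonneg (horiz u)
  by_contra h3
  have h4 : ‖horiz u‖ = 0 := le_antisymm (not_lt.mp h3) h2
  rw [h4] at h1
  nlinarith

theorem sqrt_pos_of_outer {d : ℕ} {u : Euc (d + 1)} (hu : 1 < ‖u‖) :
    0 < Real.sqrt (‖u‖ ^ 2 - 1) := Real.sqrt_pos.mpr (by nlinarith)

open Classical in
/-- The ball `b(u)` with light source `u`, also called the illuminated region of the outer-sphere
point `u`; the theorems `mem_carrier_lightBall` and `lorentzVec_lightBall` below characterize it.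
The last value, for points that are not outer-sphere, is a dummy. -/
def lightBall {d : ℕ} (u : Euc (d + 1)) : Ball d :=
  if hu : 1 < ‖u‖ then
    if h : u (Fin.last d) = 1 then
      Ball.half (‖horiz u‖⁻¹ • horiz u) ‖horiz u‖⁻¹
        (by
          have := horiz_norm_pos hu h
          rw [norm_smul, norm_inv, norm_norm, inv_mul_cancel₀ this.ne'])
    else
      Ball.round ((1 - u (Fin.last d))⁻¹ • horiz u)
        ((1 - u (Fin.last d)) / Real.sqrt (‖u‖ ^ 2 - 1))
        (div_ne_zero (sub_ne_zero.mpr (Ne.symm h)) (sqrt_pos_of_outer hu).ne')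
  else Ball.round 0 1 one_ne_zero

/-- The Lorentzian vector of `b(u)` is the positive multiple of `(u, 1)` of Lorentzian norm one. -/
theorem lorentzVec_lightBall {d : ℕ} {u : Euc (d + 1)} (hu : 1 < ‖u‖) :
    (lightBall u).lorentzVec =
      (Real.sqrt (‖u‖ ^ 2 - 1))⁻¹ • (Fin.snoc (α := fun _ => ℝ) (fun i => u i) 1) := by
  have hs := sqrt_pos_of_outer hu
  have hsq : Real.sqrt (‖u‖ ^ 2 - 1) ^ 2 = ‖u‖ ^ 2 - 1 := Real.sq_sqrt (by nlinarith)
  have hn := norm_sq_eq_horiz u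
  by_cases h : u (Fin.last d) = 1
  · have hp := horiz_norm_pos hu h
    have hr : Real.sqrt (‖u‖ ^ 2 - 1) = ‖horiz u‖ := by
      rw [hn, h]
      simp
    simp only [lightBall, hu, h, dite_true, Ball.lorentzVec, hr]
    funext i
    refine Fin.lastCases ?_ (fun j => ?_) i
    · simp
    · refine Fin.lastCases ?_ (fun k => ?_) j
      · simp [h]
      · simp [horiz]
  · have h1 : 1 - u (Fin.last d) ≠ 0 := sub_ne_zero.mpr (Ne.symm h)
    simp only [lightBall, hu, h, dite_true, dite_false, Ball.lorentzVec]
    set s := Real.sqrt (‖u‖ ^ 2 - 1) with hsdef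
    have hc : ‖(1 - u (Fin.last d))⁻¹ • horiz u‖ ^ 2
        = (s ^ 2 + 1 - u (Fin.last d) ^ 2) / (1 - u (Fin.last d)) ^ 2 := by
      rw [norm_smul, mul_pow, hsq, hn, Real.norm_eq_abs, sq_abs]
      field_simp
      ring
    rw [hc]
    funext i
    refine Fin.lastCases ?_ (fun j => ?_) i
    · simp
      field_simp
      ring
    · refine Fin.lastCases ?_ (fun k => ?_) j
      · simp
        field_simp
        ring
      · simp [horiz]
        field_simp

/-- The ball `b(u)` is the stereographic image of the part of the unit sphere illuminated
from `u`, that is, of the points `p` of the sphere with `u · p ≥ 1`. -/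
theorem mem_carrier_lightBall {d : ℕ} {u : Euc (d + 1)} (hu : 1 < ‖u‖) (z : OnePoint (Euc d)) :
    z ∈ (lightBall u).carrier ↔ 1 ≤ inner ℝ u (invStereo z) := by
  have hs := sqrt_pos_of_outer hu
  have hsq : Real.sqrt (‖u‖ ^ 2 - 1) ^ 2 = ‖u‖ ^ 2 - 1 := Real.sq_sqrt (by nlinarith)
  have hn := norm_sq_eq_horiz u
  have hinf : inner ℝ u (invStereo (OnePoint.infty : OnePoint (Euc d))) = u (Fin.last d) := by
    change inner ℝ u (WithLp.toLp 2 (Fin.snoc (α := fun _ => ℝ) (fun _ => 0) 1)) = _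
    simp [PiLp.inner_apply, Fin.sum_univ_castSucc]
  have hfin : ∀ x : Euc d, (1 ≤ inner ℝ u (invStereo (x : OnePoint (Euc d))) ↔
      ‖x‖ ^ 2 + 1 ≤ 2 * inner ℝ (horiz u) x + u (Fin.last d) * (‖x‖ ^ 2 - 1)) := by
    intro x
    have e : inner ℝ u (invStereo (x : OnePoint (Euc d))) =
        (‖x‖ ^ 2 + 1)⁻¹ * (2 * inner ℝ (horiz u) x + u (Fin.last d) * (‖x‖ ^ 2 - 1)) := by
      change inner ℝ u ((‖x‖ ^ 2 + 1)⁻¹ •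
        WithLp.toLp 2 (Fin.snoc (α := fun _ => ℝ) (fun i => 2 * x i) (‖x‖ ^ 2 - 1))) = _
      rw [inner_smul_right]
      simp only [PiLp.inner_apply, Fin.sum_univ_castSucc, Fin.snoc_castSucc, Fin.snoc_last, horiz,
        Finset.mul_sum, RCLike.inner_apply, conj_trivial]
      congr 2
      · exact Finset.sum_congr rfl fun i _ => by ring
      · ring
    rw [e, ← div_eq_inv_mul, one_le_div (by positivity)]
  by_cases h : u (Fin.last d) = 1
  · have hp := horiz_norm_pos hu h
    simp only [lightBall, hu, h, dite_true, Ball.carrier, Set.mem_ofPred_eq]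
    induction z using OnePoint.rec with
    | infty => rw [hinf, h]; simp
    | coe x =>
      rw [hfin, h]
      simp only [OnePoint.coe_ne_infty, false_or, OnePoint.coe_eq_coe, exists_eq_left',
        inner_smul_left, conj_trivial]
      rw [le_mul_iff_one_le_right (by positivity)]
      constructor <;> intro <;> linarith
  · have h1 : 1 - u (Fin.last d) ≠ 0 := sub_ne_zero.mpr (Ne.symm h)
    simp only [lightBall, hu, h, dite_true, dite_false, Ball.carrier, Set.mem_ofPred_eq]
    set s := Real.sqrt (‖u‖ ^ 2 - 1) with hsdef
    set t := 1 - u (Fin.last d) with ht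
    have hu' : u (Fin.last d) = 1 - t := by rw [ht]; ring
    have key : ∀ x : Euc d, (t ^ 2) * ‖x - t⁻¹ • horiz u‖ ^ 2 =
        t ^ 2 * ‖x‖ ^ 2 - 2 * t * inner ℝ (horiz u) x + (s ^ 2 + 1 - (1 - t) ^ 2) := by
      intro x
      rw [norm_sub_sq_real, inner_smul_right, norm_smul, mul_pow, Real.norm_eq_abs, sq_abs,
        real_inner_comm, hsq, hn, hu']
      field_simp
      ring
    rcases lt_or_gt_of_ne h1 with hneg | hpos
    · have a1 : t / s < 0 := div_neg_of_neg_of_pos hneg hs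
      simp only [a1, not_lt.mpr a1.le, false_and, false_or, true_and]
      induction z using OnePoint.rec with
      | infty => rw [hinf]; simp; linarith
      | coe x =>
        rw [hfin, hu']
        simp only [OnePoint.coe_ne_infty, false_or, OnePoint.coe_eq_coe, exists_eq_left']
        have k := key x
        rw [one_div_div, ← div_neg, ← abs_of_neg hneg, div_le_iff₀ (abs_pos.mpr h1),
          ← abs_of_nonneg hs.le, ← abs_of_nonneg (norm_nonneg (x - t⁻¹ • horiz u)), ← abs_mul,
          ← sq_le_sq]
        rw [mul_pow, mul_comm, k]
        constructor
        · intro hh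
          by_contra hc
          nlinarith
        · intro hh
          nlinarith
    · have a1 : 0 < t / s := div_pos hpos hs
      simp only [a1, not_lt.mpr a1.le, false_and, or_false, true_and]
      induction z using OnePoint.rec with
      | infty => rw [hinf]; simp; linarith
      | coe x =>
        rw [hfin, hu']
        simp only [OnePoint.coe_eq_coe, exists_eq_left']
        have k := key x
        rw [one_div_div, le_div_iff₀ hpos,
          ← abs_of_nonneg hs.le, ← abs_of_nonneg (mul_nonneg (norm_nonneg _) hpos.le),
          ← sq_le_sq]
        rw [mul_pow, mul_comm, k]
        constructor
        · intro hh
          by_contra hc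
          nlinarith
        · intro hh
          nlinarith

/-! ## Polytopes -/

variable {n : ℕ}

/-- `F` is a `k`-dimensional (nonempty) face of the convex set `P`: the set of maximizers on `P`
of a linear form (`P` itself comes from the zero form), with affine hull of dimension `k`. -/
def IsFace (k : ℕ) (P F : Set (Euc n)) : Prop :=
  F.Nonempty ∧ IsExposed ℝ P F ∧ Module.finrank ℝ (vectorSpan ℝ F) = k

/-- The vertices of a polytope. -/
def vertices (P : Set (Euc n)) : Set (Euc n) := P.extremePoints ℝ

/-- A nonempty convex set `F` is tangent to the unit sphere: it touches the sphere and its affine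
hull does not enter the open unit ball. -/
def IsTangentToUnitSphere (F : Set (Euc n)) : Prop :=
  (∃ p ∈ F, ‖p‖ = 1) ∧ ∀ x ∈ affineSpan ℝ F, 1 ≤ ‖x‖

/-- A polytope is edge-scribed when all its edges are tangent to the unit sphere. -/
def IsEdgeScribed (P : Set (Euc n)) : Prop :=
  ∀ F, IsFace 1 P F → IsTangentToUnitSphere F

/-- `P` is an `n`-simplex in the Euclidean space of dimension `n`: the convex hull of `n + 1`
affinely independent points. -/
def IsSimplex (P : Set (Euc n)) : Prop :=
  ∃ s : Affine.Simplex ℝ (Euc n) n, P = convexHull ℝ (Set.range s.points)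

/-- A flag `(f₀, …, f_n = P)` of an `n`-polytope `P`. -/
structure IsFlag (P : Set (Euc n)) (f : Fin (n + 1) → Set (Euc n)) : Prop where
  isFace : ∀ i : Fin (n + 1), IsFace (i : ℕ) P (f i)
  subset : ∀ i : Fin n, f i.castSucc ⊆ f i.succ
  last_eq : f (Fin.last n) = P

/-- The Lorentzian barycenter of an outer-sphere polytope: the average over its vertices `v` of the
Lorentzian vectors of the balls `b(v)`. -/
def lorentzBarycenter {d : ℕ} (P : Set (Euc (d + 1))) : LorentzSpace d :=
  ((vertices P).ncard : ℝ)⁻¹ • ∑ᶠ v ∈ vertices P, (lightBall v).lorentzVec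

/-- The Lorentzian curvature of an outer-sphere polytope. -/
def lorentzCurvature {d : ℕ} (P : Set (Euc (d + 1))) : ℝ := vecCurvature (lorentzBarycenter P)

end PolytopalBalls

end

open PolytopalBalls

open scoped BigOperators

noncomputable section
namespace PolytopalBalls

/-! ## The Lorentzian product -/

/-! The curvature of a ball is a linear functional of its Lorentzian vector, namely minus the
product with the light-like vector `northVec`. Everything therefore reduces to linear algebra for `d
+ 2` vectors with self-product `1` and mutual products `-1`. Their Gram matrix `2I - J`, with `J`
the all-ones matrix, is invertible because `d ≠ 0`, so they form a basis. Expanding `northVec` in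
this basis turns its light-likeness into the quadratic relation on curvatures
(`sq_sum_vecCurvature`).

Such vectors arise in two ways. For pairwise tangent balls, `Ball.Tangent.lorentzProd_eq` computes
the product from the Euclidean position: the balls share a point while their interiors are disjoint,
which fixes the distance of the centers or its analogue for half-spaces. For an edge-scribed
simplex, any two vertices span an edge, and tangency of that edge gives `⟪u, v⟫ - 1 = -√(‖u‖² - 1)
√(‖v‖² - 1)`, which is product `-1` after normalization (`lorentzProd_lightBall`).

A flag of a simplex amounts to an ordering of its vertices (`IsFlag.exists_vertex_enumeration`), so
the curvatures of its faces are the running averages of the vertex curvatures. The weighted sum of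
squared increments of running averages is half the sum of squared deviations from the mean
(`sum_choose_mul_sq_sub_average`). With the quadratic relation, this is a multiple of the squared
mean. -/

theorem lorentzProd_comm {d : ℕ} (x y : LorentzSpace d) : lorentzProd x y = lorentzProd y x := by
  simp only [lorentzProd, mul_comm]

theorem lorentzProd_add_left {d : ℕ} (x y z : LorentzSpace d) :
    lorentzProd (x + y) z = lorentzProd x z + lorentzProd y z := by
  simp only [lorentzProd, Pi.add_apply, add_mul, Finset.sum_add_distrib]
  ring

theorem lorentzProd_smul_left {d : ℕ} (a : ℝ) (x z : LorentzSpace d) :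
    lorentzProd (a • x) z = a * lorentzProd x z := by
  simp only [lorentzProd, Pi.smul_apply, smul_eq_mul, mul_sub, Finset.mul_sum, mul_assoc]

theorem lorentzProd_smul_right {d : ℕ} (a : ℝ) (x z : LorentzSpace d) :
    lorentzProd x (a • z) = a * lorentzProd x z := by
  rw [lorentzProd_comm, lorentzProd_smul_left, lorentzProd_comm]

theorem lorentzProd_sum_smul_left {d : ℕ} {ι : Type*} (s : Finset ι) (a : ι → ℝ)
    (x : ι → LorentzSpace d) (z : LorentzSpace d) :
    lorentzProd (∑ i ∈ s, a i • x i) z = ∑ i ∈ s, a i * lorentzProd (x i) z := by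
  classical
  induction s using Finset.induction_on with
  | empty => simp [lorentzProd]
  | insert i s hi ih =>
    rw [Finset.sum_insert hi, Finset.sum_insert hi, lorentzProd_add_left, lorentzProd_smul_left, ih]

theorem lorentzProd_northVec_self (d : ℕ) : lorentzProd (northVec d) (northVec d) = 0 := by
  have h1 : ∀ i : Fin (d + 1), northVec d i.castSucc = if i = Fin.last d then 1 else 0 := by
    intro i
    simp [northVec, Pi.single_apply]
  have h2 : northVec d (Fin.last (d + 1)) = 1 := by
    simp [northVec, Fin.ext_iff]
  simp [lorentzProd, h1, h2]

theorem vecCurvature_smul {d : ℕ} (a : ℝ) (x : LorentzSpace d) :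
    vecCurvature (a • x) = a * vecCurvature x := by
  simp [vecCurvature, lorentzProd_smul_right]

theorem vecCurvature_sum {d : ℕ} {ι : Type*} (s : Finset ι) (x : ι → LorentzSpace d) :
    vecCurvature (∑ i ∈ s, x i) = ∑ i ∈ s, vecCurvature (x i) := by
  have h := lorentzProd_sum_smul_left s (fun _ => 1) x (northVec d)
  simp only [one_smul, one_mul] at h
  simp only [vecCurvature, lorentzProd_comm (northVec d), h, Finset.sum_neg_distrib]

/-- The Descartes relation for the curvatures of `d + 2` unit space-like vectors with pairwise
products `-1`. -/
theorem sq_sum_vecCurvature {d : ℕ} (hd : 1 ≤ d) (x : Fin (d + 2) → LorentzSpace d)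
    (hself : ∀ i, lorentzProd (x i) (x i) = 1)
    (hne : ∀ i j, i ≠ j → lorentzProd (x i) (x j) = -1) :
    (∑ i, vecCurvature (x i)) ^ 2 = (d : ℝ) * ∑ i, vecCurvature (x i) ^ 2 := by
  have hd0 : (d : ℝ) ≠ 0 := by positivity
  -- The Gram matrix is `2I - J`. Adding the `d + 2` equations gives `-d ∑ a`, so `d ≠ 0` makes it
  -- nonsingular.
  have gram : ∀ (a : Fin (d + 2) → ℝ) (j), lorentzProd (∑ i, a i • x i) (x j)
      = 2 * a j - ∑ i, a i := by
    intro a j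
    rw [lorentzProd_sum_smul_left]
    have : ∀ i, a i * lorentzProd (x i) (x j) = (if i = j then 2 * a i else 0) - a i := by
      intro i
      split_ifs with h
      · rw [h, hself]; ring
      · rw [hne i j h]; ring
    simp [this, Finset.sum_sub_distrib]
  have hsum : ∀ (a : Fin (d + 2) → ℝ), ∑ j, (2 * a j - ∑ i, a i) = -(d * ∑ i, a i) := by
    intro a
    simp [Finset.sum_sub_distrib, ← Finset.mul_sum]
    ring
  have hli : LinearIndependent ℝ x := by
    rw [Fintype.linearIndependent_iff]
    intro a ha
    have h0 : ∀ j, 2 * a j - ∑ i, a i = 0 := by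
      intro j
      rw [← gram, ha]
      simp [lorentzProd]
    have h1 : ∑ i, a i = 0 := by
      have := hsum a
      simp only [h0, Finset.sum_const_zero] at this
      simpa [hd0] using this
    intro i
    have := h0 i
    rw [h1] at this
    linarith
  have hspan : northVec d ∈ Submodule.span ℝ (Set.range x) := by
    rw [hli.span_eq_top_of_card_eq_finrank' (by simp)]
    trivial
  obtain ⟨a, ha⟩ := (Submodule.mem_span_range_iff_exists_fun ℝ).1 hspan
  have hk : ∀ j, vecCurvature (x j) = -(2 * a j - ∑ i, a i) := by
    intro j
    rw [vecCurvature, ← gram, ha]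
  have hK : ∑ j, vecCurvature (x j) = d * ∑ i, a i := by
    simp only [hk, Finset.sum_neg_distrib, hsum, neg_neg]
  -- Up to sign this sum is the self-product of `northVec`, expanded in the basis `x`.
  have hN : ∑ j, a j * vecCurvature (x j) = 0 := by
    have h := lorentzProd_northVec_self d
    conv at h => lhs; arg 1; rw [← ha]
    rw [lorentzProd_sum_smul_left] at h
    simp only [vecCurvature, mul_neg, Finset.sum_neg_distrib, lorentzProd_comm (northVec d), h,
      neg_zero]
  have hQ : ∑ j, vecCurvature (x j) ^ 2 = (∑ i, a i) * ∑ j, vecCurvature (x j) := by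
    have h : ∀ j, vecCurvature (x j) ^ 2
        = (∑ i, a i) * vecCurvature (x j) - 2 * (a j * vecCurvature (x j)) := by
      intro j
      linear_combination vecCurvature (x j) * hk j
    simp only [h, Finset.sum_sub_distrib, ← Finset.mul_sum, hN]
    ring
  rw [hQ, hK]
  ring

/-! ## Tangent balls -/

theorem lorentzProd_snoc {d : ℕ} (x y : Fin d → ℝ) (a b a' b' : ℝ) :
    lorentzProd (Fin.snoc (α := fun _ => ℝ) (Fin.snoc (α := fun _ => ℝ) x a) b : LorentzSpace d)
      (Fin.snoc (α := fun _ => ℝ) (Fin.snoc (α := fun _ => ℝ) y a') b')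
      = ∑ i, x i * y i + a * a' - b * b' := by
  simp [lorentzProd, Fin.sum_univ_castSucc]

theorem inner_eq_sum {n : ℕ} (x y : Euc n) : inner ℝ x y = ∑ i, x i * y i := by
  simp [PiLp.inner_apply, mul_comm]

namespace Ball

variable {d : ℕ}

theorem lorentzProd_round_round (c c' : Euc d) {k k' : ℝ} (hk : k ≠ 0) (hk' : k' ≠ 0) :
    lorentzProd (round c k hk).lorentzVec (round c' k' hk').lorentzVec
      = k * k' / 2 * ((k ^ 2)⁻¹ + (k' ^ 2)⁻¹ - ‖c - c'‖ ^ 2) := by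
  have h : ∑ i, 2 * c i * (2 * c' i) = 4 * inner ℝ c c' := by
    rw [inner_eq_sum, Finset.mul_sum]
    exact Finset.sum_congr rfl fun i _ => by ring
  rw [lorentzVec, lorentzVec, lorentzProd_smul_left, lorentzProd_smul_right, lorentzProd_snoc, h,
    norm_sub_sq_real]
  ring

theorem lorentzProd_round_half (c n : Euc d) {k δ : ℝ} (hk : k ≠ 0) (hn : ‖n‖ = 1) :
    lorentzProd (round c k hk).lorentzVec (half n δ hn).lorentzVec
      = k * (inner ℝ n c - δ) := by
  have h : ∑ i, 2 * c i * n i = 2 * inner ℝ n c := by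
    rw [inner_eq_sum, Finset.mul_sum]
    exact Finset.sum_congr rfl fun i _ => by ring
  rw [lorentzVec, lorentzVec, lorentzProd_smul_left, lorentzProd_snoc, h]
  ring

theorem lorentzProd_half_half (n n' : Euc d) {δ δ' : ℝ} (hn : ‖n‖ = 1) (hn' : ‖n'‖ = 1) :
    lorentzProd (half n δ hn).lorentzVec (half n' δ' hn').lorentzVec = inner ℝ n n' := by
  rw [lorentzVec, lorentzVec, lorentzProd_snoc, inner_eq_sum]
  ring

theorem lorentzProd_self (b : Ball d) : lorentzProd b.lorentzVec b.lorentzVec = 1 := by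
  cases b with
  | round c k hk =>
    rw [lorentzProd_round_round]
    simp
    field_simp
    norm_num
  | half n δ hn =>
    rw [lorentzProd_half_half, real_inner_self_eq_norm_sq, hn]
    norm_num

/-- The points of `ℝ^d` in the topological interior of a ball. -/
def finiteInterior : Ball d → Set (Euc d)
  | round c k _ => {x | (0 < k ∧ ‖x - c‖ < 1 / k) ∨ (k < 0 ∧ -(1 / k) < ‖x - c‖)}
  | half n δ _ => {x | δ < inner ℝ n x}

theorem isOpen_finiteInterior (b : Ball d) : IsOpen b.finiteInterior := by
  cases b with
  | round c k hk =>
    have h1 : IsOpen {x : Euc d | ‖x - c‖ < 1 / k} := isOpen_lt (by fun_prop) (by fun_prop)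
    have h2 : IsOpen {x : Euc d | -(1 / k) < ‖x - c‖} := isOpen_lt (by fun_prop) (by fun_prop)
    rcases lt_or_gt_of_ne hk with h | h
    · simpa [finiteInterior, h, h.not_gt] using h2
    · simpa [finiteInterior, h, h.not_gt] using h1
  | half n δ hn => exact isOpen_lt (by fun_prop) (by fun_prop)

theorem coe_mem_carrier {b : Ball d} {x : Euc d} (hx : x ∈ b.finiteInterior) :
    (x : OnePoint (Euc d)) ∈ b.carrier := by
  cases b with
  | round c k hk =>
    rcases hx with ⟨h, h'⟩ | ⟨h, h'⟩
    · exact Or.inl ⟨h, x, rfl, h'.le⟩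
    · exact Or.inr ⟨h, Or.inr ⟨x, rfl, h'.le⟩⟩
  | half n δ hn => exact Or.inr ⟨x, rfl, le_of_lt hx⟩

theorem Tangent.symm {b b' : Ball d} (h : b.Tangent b') : b'.Tangent b := by
  obtain ⟨z, hz⟩ := h
  exact ⟨z, by rw [Set.inter_comm, hz]⟩

/-- A common interior point would have a whole neighbourhood in both balls, which is infinite since
`d ≥ 1`; tangent balls share only one point. -/
theorem Tangent.notMem_finiteInterior (hd : 1 ≤ d) {b b' : Ball d} (h : b.Tangent b') {x : Euc d}
    (hx : x ∈ b.finiteInterior) : x ∉ b'.finiteInterior := by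
  intro hx'
  have : Nonempty (Fin d) := ⟨⟨0, hd⟩⟩
  obtain ⟨z, hz⟩ := h
  have hnt := infinite_of_mem_nhds x
    ((b.isOpen_finiteInterior.inter b'.isOpen_finiteInterior).mem_nhds ⟨hx, hx'⟩)
  obtain ⟨y, hy, hyx⟩ := hnt.nontrivial.exists_ne x
  have e : ∀ y, y ∈ b.finiteInterior ∩ b'.finiteInterior → (y : OnePoint (Euc d)) = z := by
    intro y hy
    have : (y : OnePoint (Euc d)) ∈ b.carrier ∩ b'.carrier :=
      ⟨coe_mem_carrier hy.1, coe_mem_carrier hy.2⟩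
    rwa [hz] at this
  exact hyx (OnePoint.coe_injective ((e y hy).trans (e x ⟨hx, hx'⟩).symm))

theorem exists_norm_one (hd : 1 ≤ d) : ∃ e : Euc d, ‖e‖ = 1 :=
  ⟨EuclideanSpace.single ⟨0, hd⟩ 1, by simp⟩

theorem exists_norm_one_eq_smul (hd : 1 ≤ d) (x : Euc d) : ∃ e : Euc d, ‖e‖ = 1 ∧ x = ‖x‖ • e := by
  by_cases hx : x = 0
  · obtain ⟨e, he⟩ := exists_norm_one hd
    exact ⟨e, he, by simp [hx]⟩
  · have := norm_ne_zero_iff.2 hx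
    exact ⟨‖x‖⁻¹ • x, by rw [norm_smul, norm_inv, norm_norm, inv_mul_cancel₀ this],
      by rw [smul_smul, mul_inv_cancel₀ this, one_smul]⟩

/-- The common point bounds the distance above by the triangle inequality; disjointness of the open
balls bounds it below. -/
theorem Tangent.dist_eq_of_pos_of_pos (hd : 1 ≤ d) {c c' : Euc d} {k k' : ℝ} {hk : k ≠ 0}
    {hk' : k' ≠ 0} (h : (round c k hk).Tangent (round c' k' hk')) (h0 : 0 < k) (h0' : 0 < k') :
    ‖c - c'‖ = 1 / k + 1 / k' := by
  apply le_antisymm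
  · obtain ⟨z, hz⟩ := h
    have hmem : z ∈ (round c k hk).carrier ∩ (round c' k' hk').carrier := by rw [hz]; rfl
    simp only [carrier, h0, h0', h0.not_gt, h0'.not_gt, true_and, false_and, or_false,
      Set.mem_inter_iff, Set.mem_ofPred_eq] at hmem
    obtain ⟨⟨x, hx, hxc⟩, y, hy, hyc⟩ := hmem
    obtain rfl : x = y := OnePoint.coe_injective (hx.symm.trans hy)
    calc ‖c - c'‖ = ‖(x - c') - (x - c)‖ := by congr 1; abel
      _ ≤ _ := (norm_sub_le _ _).trans (by linarith)
  · by_contra hlt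
    push Not at hlt
    have hnd : ¬ Disjoint (Metric.ball c (1 / k)) (Metric.ball c' (1 / k')) := by
      rw [disjoint_ball_ball_iff (by positivity) (by positivity), dist_eq_norm]
      exact not_le.2 hlt
    obtain ⟨x, hx, hx'⟩ := Set.not_disjoint_iff.1 hnd
    rw [mem_ball_iff_norm] at hx hx'
    exact h.notMem_finiteInterior hd (Or.inl ⟨h0, hx⟩) (Or.inl ⟨h0', hx'⟩)

/-- The closed ball touches from inside the sphere of radius `-1/k'` bounding the other ball, so the
roles are reversed: disjoint interiors give the upper bound, the common point the lower one. -/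
theorem Tangent.dist_eq_of_pos_of_neg (hd : 1 ≤ d) {c c' : Euc d} {k k' : ℝ} {hk : k ≠ 0}
    {hk' : k' ≠ 0} (h : (round c k hk).Tangent (round c' k' hk')) (h0 : 0 < k) (h0' : k' < 0) :
    ‖c - c'‖ = -(1 / k + 1 / k') := by
  apply le_antisymm
  · by_contra hlt
    push Not at hlt
    obtain ⟨e, he, hce⟩ := exists_norm_one_eq_smul hd (c - c')
    -- Moving from `c` straight away from `c'` by `s` stays inside the first ball yet crosses the
    -- sphere bounding the second.
    obtain ⟨s, hs, hs'⟩ : ∃ s, max 0 (-(1 / k') - ‖c - c'‖) < s ∧ s < 1 / k :=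
      exists_between (max_lt (by positivity) (by linarith))
    obtain ⟨hs0, hs1⟩ := max_lt_iff.1 hs
    refine h.notMem_finiteInterior hd (x := c + s • e) (Or.inl ⟨h0, ?_⟩) (Or.inr ⟨h0', ?_⟩)
    · rw [add_sub_cancel_left, norm_smul, he, Real.norm_eq_abs, abs_of_pos hs0, mul_one]
      exact hs'
    · have : c + s • e - c' = (‖c - c'‖ + s) • e := by
        rw [add_smul, ← hce]; abel
      rw [this, norm_smul, he, mul_one, Real.norm_eq_abs, abs_of_pos (by positivity)]
      linarith
  · obtain ⟨z, hz⟩ := h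
    have hmem : z ∈ (round c k hk).carrier ∩ (round c' k' hk').carrier := by rw [hz]; rfl
    simp only [carrier, h0, h0', h0.not_gt, h0'.not_gt, true_and, false_and, or_false, false_or,
      Set.mem_inter_iff, Set.mem_ofPred_eq] at hmem
    obtain ⟨⟨x, hx, hxc⟩, h2⟩ := hmem
    rcases h2 with h2 | ⟨y, hy, hyc⟩
    · exact absurd (hx.symm.trans h2) (OnePoint.coe_ne_infty x)
    obtain rfl : x = y := OnePoint.coe_injective (hx.symm.trans hy)
    have : ‖x - c'‖ ≤ ‖x - c‖ + ‖c - c'‖ := norm_sub_le_norm_sub_add_norm_sub _ _ _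
    linarith

theorem eventually_mem_finiteInterior_of_neg {c : Euc d} {k : ℝ} (hk : k ≠ 0) (h0 : k < 0)
    {e : Euc d} (he : e ≠ 0) : ∀ᶠ t : ℝ in Filter.atTop, t • e ∈ (round c k hk).finiteInterior := by
  have hp := norm_pos_iff.2 he
  filter_upwards [Filter.eventually_gt_atTop ((-(1 / k) + ‖c‖) / ‖e‖),
    Filter.eventually_ge_atTop 0] with t ht ht0
  refine Or.inr ⟨h0, ?_⟩
  rw [div_lt_iff₀ hp] at ht
  have h1 : ‖t • e‖ = t * ‖e‖ := by rw [norm_smul, Real.norm_eq_abs, abs_of_nonneg ht0]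
  have := norm_sub_norm_le (t • e) c
  linarith

theorem eventually_mem_finiteInterior_half {n e : Euc d} {δ : ℝ} (hn : ‖n‖ = 1)
    (he : 0 < inner ℝ n e) :
    ∀ᶠ t : ℝ in Filter.atTop, t • e ∈ (half n δ hn).finiteInterior := by
  filter_upwards [Filter.eventually_gt_atTop (δ / inner ℝ n e)] with t ht
  rw [div_lt_iff₀ he] at ht
  simpa [finiteInterior, inner_smul_right] using ht

/-- This excludes the configurations whose interiors overlap far out along a ray. -/
theorem Tangent.not_eventually (hd : 1 ≤ d) {b b' : Ball d} (h : b.Tangent b') {e : Euc d}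
    (h1 : ∀ᶠ t : ℝ in Filter.atTop, t • e ∈ b.finiteInterior) :
    ¬ ∀ᶠ t : ℝ in Filter.atTop, t • e ∈ b'.finiteInterior := by
  intro h2
  obtain ⟨t, ht, ht'⟩ := (h1.and h2).exists
  exact h.notMem_finiteInterior hd ht ht'

/-- The exterior of a ball meets every half-space far out along `n`, so `k > 0`. The center then
lies at distance exactly `1/k` outside the half-space, again by comparing a common point with
disjoint interiors. -/
theorem Tangent.inner_sub_eq (hd : 1 ≤ d) {c n : Euc d} {k δ : ℝ} {hk : k ≠ 0} {hn : ‖n‖ = 1}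
    (h : (round c k hk).Tangent (half n δ hn)) : inner ℝ n c - δ = -(1 / k) := by
  have hnn : inner ℝ n n = (1 : ℝ) := by rw [real_inner_self_eq_norm_sq, hn]; norm_num
  rcases lt_or_gt_of_ne hk with h0 | h0
  · exact absurd (eventually_mem_finiteInterior_half hn (by rw [hnn]; norm_num))
      (h.not_eventually hd (eventually_mem_finiteInterior_of_neg hk h0
        (norm_ne_zero_iff.1 (by rw [hn]; norm_num))))
  apply le_antisymm
  · by_contra hlt
    push Not at hlt
    obtain ⟨s, hs, hs'⟩ : ∃ s, max 0 (δ - inner ℝ n c) < s ∧ s < 1 / k :=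
      exists_between (max_lt (by positivity) (by linarith))
    obtain ⟨hs0, hs1⟩ := max_lt_iff.1 hs
    refine h.notMem_finiteInterior hd (x := c + s • n) (Or.inl ⟨h0, ?_⟩) ?_
    · rw [add_sub_cancel_left, norm_smul, hn, Real.norm_eq_abs, abs_of_pos hs0, mul_one]
      exact hs'
    · change δ < inner ℝ n (c + s • n)
      rw [inner_add_right, inner_smul_right, hnn]
      linarith
  · obtain ⟨z, hz⟩ := h
    have hmem : z ∈ (round c k hk).carrier ∩ (half n δ hn).carrier := by rw [hz]; rfl
    simp only [carrier, h0, h0.not_gt, true_and, false_and, or_false,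
      Set.mem_inter_iff, Set.mem_ofPred_eq] at hmem
    obtain ⟨⟨x, hx, hxc⟩, h2⟩ := hmem
    rcases h2 with h2 | ⟨y, hy, hyc⟩
    · exact absurd (hx.symm.trans h2) (OnePoint.coe_ne_infty x)
    obtain rfl : x = y := OnePoint.coe_injective (hx.symm.trans hy)
    have h3 := real_inner_le_norm n (x - c)
    rw [hn, one_mul, inner_sub_right] at h3
    linarith

/-- Tangent balls have Lorentzian product `-1`. -/
theorem Tangent.lorentzProd_eq (hd : 1 ≤ d) {b b' : Ball d} (h : b.Tangent b') :
    lorentzProd b.lorentzVec b'.lorentzVec = -1 := by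
  have round_round : ∀ {c c' : Euc d} {k k' : ℝ} (hk : k ≠ 0) (hk' : k' ≠ 0),
      ‖c - c'‖ ^ 2 = (1 / k + 1 / k') ^ 2 →
      lorentzProd (round c k hk).lorentzVec (round c' k' hk').lorentzVec = -1 := by
    intro c c' k k' hk hk' h
    rw [lorentzProd_round_round, h]
    field_simp
    ring
  cases b with
  | round c k hk =>
    cases b' with
    | round c' k' hk' =>
      rcases lt_or_gt_of_ne hk with h0 | h0 <;> rcases lt_or_gt_of_ne hk' with h0' | h0'
      -- Two exteriors of balls always overlap near infinity.
      · obtain ⟨e, he⟩ := exists_norm_one hd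
        have he0 : e ≠ 0 := norm_ne_zero_iff.1 (by rw [he]; norm_num)
        exact absurd (eventually_mem_finiteInterior_of_neg hk' h0' he0)
          (h.not_eventually hd (eventually_mem_finiteInterior_of_neg hk h0 he0))
      · apply round_round
        rw [norm_sub_rev, h.symm.dist_eq_of_pos_of_neg hd h0' h0]
        ring
      · apply round_round
        rw [h.dist_eq_of_pos_of_neg hd h0 h0']
        ring
      · exact round_round _ _ (by rw [h.dist_eq_of_pos_of_pos hd h0 h0'])
    | half n δ hn =>
      rw [lorentzProd_round_half, h.inner_sub_eq hd]
      field_simp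
  | half n δ hn =>
    cases b' with
    | round c k hk =>
      rw [lorentzProd_comm, lorentzProd_round_half, h.symm.inner_sub_eq hd]
      field_simp
    | half n' δ' hn' =>
      rw [lorentzProd_half_half]
      by_contra hne
      have hge := neg_le_of_abs_le (abs_real_inner_le_norm n n')
      rw [hn, hn', one_mul] at hge
      have hpos : 0 < 1 + inner ℝ n n' := by
        have := lt_of_le_of_ne hge (Ne.symm hne)
        linarith
      -- Unless `n' = -n`, the bisecting direction `n + n'` points into both half-spaces: its
      -- product with either normal is `1 + ⟪n, n'⟫ > 0`.
      refine h.not_eventually hd (e := n + n') (eventually_mem_finiteInterior_half hn ?_)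
        (eventually_mem_finiteInterior_half hn' ?_)
      · rw [inner_add_right, real_inner_self_eq_norm_sq, hn]
        linarith
      · rw [inner_add_right, real_inner_self_eq_norm_sq, hn', real_inner_comm]
        linarith

end Ball

/-! ## Faces of a simplex -/

section Simplex

variable {n : ℕ} {ι : Type*}

theorem finrank_vectorSpan_convexHull_image (b : AffineBasis ι ℝ (Euc n)) {S : Finset ι} {k : ℕ}
    (hS : S.card = k + 1) :
    Module.finrank ℝ (vectorSpan ℝ (convexHull ℝ (b '' S))) = k := by
  classical
  rw [← direction_affineSpan, affineSpan_convexHull, direction_affineSpan, ← Finset.coe_image]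
  exact b.ind.finrank_vectorSpan_image_finset hS

variable [Fintype ι]

/-- By Krein–Milman the set of maximizers is the closed hull of its extreme points; these are
extreme in the whole hull, hence are among the `p i`. -/
theorem toExposed_convexHull_range (l : StrongDual ℝ (Euc n)) (p : ι → Euc n) :
    l.toExposed (convexHull ℝ (Set.range p))
      = convexHull ℝ (p '' {i | ∀ j, l (p j) ≤ l (p i)}) := by
  have hexp : IsExposed ℝ (convexHull ℝ (Set.range p)) (l.toExposed (convexHull ℝ (Set.range p))) :=
    ContinuousLinearMap.toExposed.isExposed
  have hcomp := (Set.finite_range p).isCompact_convexHull (𝕜 := ℝ)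
  apply Set.Subset.antisymm
  · rw [← closure_convexHull_extremePoints (hexp.isCompact hcomp)
      (hexp.convex (convex_convexHull ℝ _))]
    refine closure_minimal (convexHull_mono ?_) ((Set.toFinite _).isClosed_convexHull (𝕜 := ℝ))
    intro x hx
    obtain ⟨i, rfl⟩ := extremePoints_convexHull_subset
      (hexp.isExtreme.extremePoints_subset_extremePoints hx)
    exact ⟨i, fun j => (extremePoints_subset hx).2 _ (subset_convexHull ℝ _ ⟨j, rfl⟩), rfl⟩
  · refine convexHull_min ?_ (hexp.convex (convex_convexHull ℝ _))
    rintro _ ⟨i, hi, rfl⟩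
    refine ⟨subset_convexHull ℝ _ ⟨i, rfl⟩, fun y hy => ?_⟩
    have : convexHull ℝ (Set.range p) ⊆ {y | l y ≤ l (p i)} := by
      refine convexHull_min ?_ (convex_halfSpace_le l.toLinearMap.isLinear _)
      rintro _ ⟨j, rfl⟩
      exact hi j
    exact this hy

/-- The sum of the barycentric coordinates indexed by `S` is `1` at the vertices in `S` and `0` at
the others, so its linear part exposes their hull. Empty `S` is separate, since this form would then
expose the whole simplex. -/
theorem isExposed_convexHull_image (b : AffineBasis ι ℝ (Euc n)) (S : Finset ι) :
    IsExposed ℝ (convexHull ℝ (Set.range b)) (convexHull ℝ (b '' S)) := by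
  classical
  rcases S.eq_empty_or_nonempty with rfl | ⟨i₀, hi₀⟩
  · simpa using isExposed_empty
  have hφ : ∃ φ : Euc n →ᵃ[ℝ] ℝ, ∀ i, φ (b i) = if i ∈ S then 1 else 0 :=
    ⟨(∑ k ∈ S, LinearMap.proj (R := ℝ) (φ := fun _ : ι => ℝ) k).toAffineMap.comp b.coords,
      fun i => by simp [AffineBasis.coord_apply]⟩
  obtain ⟨φ, hφ⟩ := hφ
  have hl : ∀ x y, φ.linear.toContinuousLinearMap y ≤ φ.linear.toContinuousLinearMap x
      ↔ φ y ≤ φ x := by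
    intro x y
    rw [← sub_nonneg, ← sub_nonneg (b := φ y), ← map_sub]
    exact iff_of_eq (congrArg _ (φ.linearMap_vsub x y))
  have : (S : Set ι) = {i | ∀ j, φ.linear.toContinuousLinearMap (b j)
      ≤ φ.linear.toContinuousLinearMap (b i)} := by
    ext i
    simp only [hl, hφ, Set.mem_ofPred_eq, Finset.mem_coe]
    constructor
    · intro hi j
      rw [if_pos hi]
      split_ifs <;> norm_num
    · intro h
      by_contra hi
      have := h i₀
      rw [if_pos hi₀, if_neg hi] at this
      norm_num at this
  rw [this, ← toExposed_convexHull_range]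
  exact ContinuousLinearMap.toExposed.isExposed

theorem vertices_convexHull_range (b : AffineBasis ι ℝ (Euc n)) :
    vertices (convexHull ℝ (Set.range b)) = Set.range b := by
  refine Set.Subset.antisymm extremePoints_convexHull_subset ?_
  rintro _ ⟨i, rfl⟩
  have h := (isExposed_convexHull_image b {i}).isExtreme
  rw [Finset.coe_singleton, Set.image_singleton, convexHull_singleton, isExtreme_singleton] at h
  exact h

theorem vertices_convexHull_image (b : AffineBasis ι ℝ (Euc n)) (S : Finset ι) :
    vertices (convexHull ℝ (b '' S)) = b '' S := by
  refine Set.Subset.antisymm extremePoints_convexHull_subset ?_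
  rw [vertices, (isExposed_convexHull_image b S).isExtreme.extremePoints_eq]
  change _ ⊆ _ ∩ vertices _
  rw [vertices_convexHull_range]
  exact Set.subset_inter (subset_convexHull ℝ _) (Set.image_subset_range _ _)

theorem isFace_convexHull_image (b : AffineBasis ι ℝ (Euc n)) {S : Finset ι} {k : ℕ}
    (hS : S.card = k + 1) :
    IsFace k (convexHull ℝ (Set.range b)) (convexHull ℝ (b '' S)) := by
  refine ⟨?_, isExposed_convexHull_image b S, finrank_vectorSpan_convexHull_image b hS⟩
  have : S.Nonempty := Finset.card_pos.1 (by omega)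
  exact (Set.Nonempty.image _ this).convexHull

theorem IsFace.exists_finset {b : AffineBasis ι ℝ (Euc n)} {k : ℕ} {F : Set (Euc n)}
    (hF : IsFace k (convexHull ℝ (Set.range b)) F) :
    ∃ S : Finset ι, S.card = k + 1 ∧ F = convexHull ℝ (b '' S) := by
  classical
  obtain ⟨hne, hexp, hrank⟩ := hF
  obtain ⟨l, hl⟩ := hexp hne
  let S : Finset ι := Finset.univ.filter fun i => ∀ j, l (b j) ≤ l (b i)
  have hS : F = convexHull ℝ (b '' S) := by
    rw [hl, Finset.coe_filter_univ, ← toExposed_convexHull_range]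
    rfl
  have hSne : S.Nonempty := by
    rw [Finset.nonempty_iff_ne_empty]
    intro h0
    rw [hS, h0] at hne
    simp at hne
  obtain ⟨m, hm⟩ : ∃ m, S.card = m + 1 := ⟨S.card - 1, by have := hSne.card_pos; omega⟩
  refine ⟨S, ?_, hS⟩
  rw [hS, finrank_vectorSpan_convexHull_image b hm] at hrank
  omega

end Simplex

theorem IsSimplex.exists_affineBasis {n : ℕ} {T : Set (Euc n)} (hT : IsSimplex T) :
    ∃ b : AffineBasis (Fin (n + 1)) ℝ (Euc n), T = convexHull ℝ (Set.range b) := by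
  obtain ⟨s, rfl⟩ := hT
  refine ⟨⟨s.points, s.independent, ?_⟩, rfl⟩
  rw [s.independent.affineSpan_eq_top_iff_card_eq_finrank_add_one]
  simp

/-- A chain of sets of cardinalities `1, …, m + 1` consists of the initial segments of an
enumeration. -/
theorem exists_enumeration_of_chain {α : Type*} {m : ℕ} (S : Fin (m + 1) → Finset α)
    (hcard : ∀ i, (S i).card = (i : ℕ) + 1) (hmono : Monotone S) :
    ∃ σ : Fin (m + 1) → α, Function.Injective σ ∧ ∀ i, (S i : Set α) = σ '' {j | j ≤ i} := by
  classical
  -- `σ i` is an element that is new at stage `i`; being absent from the preceding set suffices, by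
  -- monotonicity.
  have hex : ∀ i, ∃ a ∈ S i, ∀ j < i, a ∉ S j := by
    intro i
    rcases Fin.eq_zero_or_eq_succ i with rfl | ⟨k, rfl⟩
    · obtain ⟨a, ha⟩ := Finset.card_pos.1 (by rw [hcard 0]; omega)
      exact ⟨a, ha, fun j hj => absurd hj (Fin.not_lt_zero j)⟩
    · obtain ⟨a, ha, ha'⟩ := Finset.exists_mem_notMem_of_card_lt_card
        (s := S k.castSucc) (t := S k.succ) (by simp [hcard])
      exact ⟨a, ha, fun j hj hja => ha' (hmono (Fin.le_castSucc_iff.2 hj) hja)⟩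
  choose σ hσ hσ' using hex
  have hinj : Function.Injective σ := by
    intro i j hij
    rcases lt_trichotomy i j with h | h | h
    · exact absurd (hij ▸ hσ i) (hσ' j i h)
    · exact h
    · exact absurd (hij ▸ hσ j) (hσ' i j h)
  refine ⟨σ, hinj, fun i => ?_⟩
  have : (Finset.Iic i).image σ = S i := by
    refine Finset.eq_of_subset_of_card_le ?_ ?_
    · intro a ha
      obtain ⟨j, hj, rfl⟩ := Finset.mem_image.1 ha
      exact hmono (Finset.mem_Iic.1 hj) (hσ j)
    · rw [Finset.card_image_of_injective _ hinj, hcard, Fin.card_Iic]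
  rw [← this, Finset.coe_image, Finset.coe_Iic]
  rfl

/-- The vertices of the faces of a flag of a simplex are the initial segments of an enumeration of
the vertices. -/
theorem IsFlag.exists_vertex_enumeration {n : ℕ} {b : AffineBasis (Fin (n + 1)) ℝ (Euc n)}
    {f : Fin (n + 1) → Set (Euc n)} (hf : IsFlag (convexHull ℝ (Set.range b)) f) :
    ∃ σ : Fin (n + 1) → Fin (n + 1), Function.Injective σ ∧
      ∀ i, vertices (f i) = (b ∘ σ) '' {j | j ≤ i} := by
  choose S hcard hS using fun i => (hf.isFace i).exists_finset
  have hv : ∀ i, vertices (f i) = b '' S i := fun i => by rw [hS i, vertices_convexHull_image]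
  have hmono : Monotone S := by
    refine Fin.monotone_iff_le_succ.2 fun i => ?_
    -- The extreme points of a face are those of the simplex lying in it, so nested faces have
    -- nested vertex sets.
    have hsub : b '' S i.castSucc ⊆ b '' S i.succ := by
      rw [← hv, ← hv, vertices, vertices, (hf.isFace i.castSucc).2.1.isExtreme.extremePoints_eq,
        (hf.isFace i.succ).2.1.isExtreme.extremePoints_eq]
      exact Set.inter_subset_inter_left _ (hf.subset i)
    exact_mod_cast (Set.image_subset_image_iff b.ind.injective).1 hsub
  obtain ⟨σ, hσ, h⟩ := exists_enumeration_of_chain S hcard hmono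
  exact ⟨σ, hσ, fun i => by rw [hv, h, Set.image_comp]⟩

/-! ## Edge-scribed simplices -/

theorem inner_eq_zero_of_forall_one_le_norm {E : Type*} [NormedAddCommGroup E]
    [InnerProductSpace ℝ E] {p w : E} (hp : ‖p‖ = 1) (h : ∀ t : ℝ, 1 ≤ ‖p + t • w‖) :
    inner ℝ p w = 0 := by
  set a : ℝ := inner ℝ p w with ha
  have hq : 0 ≤ ‖w‖ ^ 2 := by positivity
  have key : ∀ t : ℝ, 0 ≤ 2 * t * a + t ^ 2 * ‖w‖ ^ 2 := by
    intro t
    have h1 : 1 ≤ ‖p + t • w‖ ^ 2 := one_le_pow₀ (h t)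
    rw [norm_add_sq_real, hp, inner_smul_right, norm_smul, mul_pow, Real.norm_eq_abs, sq_abs,
      ← ha] at h1
    linarith
  -- A near-minimizer of the quadratic in `t`; the `+ 1` keeps the denominator nonzero when `w = 0`.
  have h1 := key (-a / (‖w‖ ^ 2 + 1))
  have h2 : 2 * (-a / (‖w‖ ^ 2 + 1)) * a + (-a / (‖w‖ ^ 2 + 1)) ^ 2 * ‖w‖ ^ 2
      = -(a ^ 2 * (‖w‖ ^ 2 + 2) / (‖w‖ ^ 2 + 1) ^ 2) := by
    field_simp
    ring
  rw [h2, neg_nonneg] at h1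
  by_contra hne
  have : 0 < a ^ 2 * (‖w‖ ^ 2 + 2) / (‖w‖ ^ 2 + 1) ^ 2 := by positivity
  linarith

theorem IsTangentToUnitSphere.one_le_norm_add_smul {n : ℕ} {u v : Euc n}
    (h : IsTangentToUnitSphere (convexHull ℝ {u, v})) (t : ℝ) : 1 ≤ ‖u + t • (v - u)‖ := by
  apply h.2
  rw [affineSpan_convexHull]
  have := AffineMap.lineMap_mem_affineSpan_pair t u v
  rwa [AffineMap.lineMap_apply, vsub_eq_sub, vadd_eq_add, add_comm] at this

/-- The point of contact `p` is orthogonal to the edge direction `w`. Writing `u = p - t w` and `v =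
p + (1 - t) w`, Pythagoras gives the tangent lengths `t‖w‖` and `(1 - t)‖w‖`, both nonnegative
because `p` lies on the segment. -/
theorem IsTangentToUnitSphere.inner_sub_one {n : ℕ} {u v : Euc n}
    (h : IsTangentToUnitSphere (convexHull ℝ {u, v})) :
    inner ℝ u v - 1 = -(Real.sqrt (‖u‖ ^ 2 - 1) * Real.sqrt (‖v‖ ^ 2 - 1)) := by
  obtain ⟨p, hp, hp1⟩ := h.1
  rw [convexHull_pair, segment_eq_image'] at hp
  obtain ⟨t, ⟨ht0, ht1⟩, rfl⟩ := hp
  set w := v - u with hw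
  set p := u + t • w with hpdef
  replace hp1 : ‖p‖ = 1 := hp1
  have horth : inner ℝ p w = 0 := by
    refine inner_eq_zero_of_forall_one_le_norm hp1 fun s => ?_
    rw [hpdef, add_assoc, ← add_smul]
    exact h.one_le_norm_add_smul (t + s)
  have hu : u = p + (-t) • w := by rw [hpdef]; module
  have hv : v = p + (1 - t) • w := by rw [hpdef, hw]; module
  have hnorm : ∀ s : ℝ, ‖p + s • w‖ ^ 2 - 1 = (s * ‖w‖) ^ 2 := by
    intro s
    rw [norm_add_sq_real, hp1, inner_smul_right, horth, norm_smul, mul_pow, Real.norm_eq_abs,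
      sq_abs]
    ring
  have hnu : ‖u‖ ^ 2 - 1 = (t * ‖w‖) ^ 2 := by rw [hu, hnorm]; ring
  have hnv : ‖v‖ ^ 2 - 1 = ((1 - t) * ‖w‖) ^ 2 := by rw [hv, hnorm]
  rw [hnu, hnv, Real.sqrt_sq (by positivity),
    Real.sqrt_sq (mul_nonneg (by linarith) (norm_nonneg _))]
  have hinner : ∀ s r : ℝ, inner ℝ (p + s • w) (p + r • w) = 1 + s * r * ‖w‖ ^ 2 := by
    intro s r
    simp only [inner_add_left, inner_add_right, real_inner_smul_left, real_inner_smul_right,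
      real_inner_comm p w, horth, real_inner_self_eq_norm_sq, hp1]
    ring
  have huv : inner ℝ u v = 1 + -t * (1 - t) * ‖w‖ ^ 2 := by rw [← hinner, ← hu, ← hv]
  rw [huv]
  ring

theorem IsEdgeScribed.isTangentToUnitSphere {n : ℕ} {ι : Type*} [Fintype ι]
    {b : AffineBasis ι ℝ (Euc n)} (h : IsEdgeScribed (convexHull ℝ (Set.range b))) {i j : ι}
    (hij : i ≠ j) : IsTangentToUnitSphere (convexHull ℝ {b i, b j}) := by
  classical
  apply h
  have := isFace_convexHull_image b (S := {i, j}) (Finset.card_pair hij)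
  simpa [Set.image_pair] using this

/-- If a vertex were on the sphere, every edge from it would be orthogonal to it. These edges span
the space, so the vertex would be orthogonal to itself. -/
theorem IsEdgeScribed.one_lt_norm {n : ℕ} {ι : Type*} [Fintype ι] [Nontrivial ι]
    {b : AffineBasis ι ℝ (Euc n)} (h : IsEdgeScribed (convexHull ℝ (Set.range b))) (i : ι) :
    1 < ‖b i‖ := by
  have hge : 1 ≤ ‖b i‖ := by
    obtain ⟨j, hj⟩ := exists_ne i
    simpa using (h.isTangentToUnitSphere hj.symm).one_le_norm_add_smul 0
  refine lt_of_le_of_ne hge fun h1 => ?_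
  have horth : ∀ j, inner ℝ (b i) (b j - b i) = 0 := by
    intro j
    rcases eq_or_ne i j with rfl | hij
    · simp
    · exact inner_eq_zero_of_forall_one_le_norm h1.symm
        (h.isTangentToUnitSphere hij).one_le_norm_add_smul
  have hspan : Submodule.span ℝ (Set.range fun j => b j -ᵥ b i) = ⊤ := by
    rw [← vectorSpan_range_eq_span_range_vsub_right, ← direction_affineSpan, b.tot,
      AffineSubspace.direction_top]
  have hle : Submodule.span ℝ (Set.range fun j => b j -ᵥ b i)
      ≤ LinearMap.ker (innerSL ℝ (b i)).toLinearMap := by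
    rw [Submodule.span_le]
    rintro _ ⟨j, rfl⟩
    simpa using horth j
  rw [hspan] at hle
  have h0 : inner ℝ (b i) (b i) = (0 : ℝ) := hle (x := b i) trivial
  rw [real_inner_self_eq_norm_sq, ← h1] at h0
  norm_num at h0

theorem lorentzProd_lightBall {d : ℕ} {u v : Euc (d + 1)} (hu : 1 < ‖u‖) (hv : 1 < ‖v‖)
    (h : IsTangentToUnitSphere (convexHull ℝ {u, v})) :
    lorentzProd (lightBall u).lorentzVec (lightBall v).lorentzVec = -1 := by
  have e : ∀ u v : Euc (d + 1), lorentzProd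
      (Fin.snoc (α := fun _ => ℝ) (fun i => u i) 1 : LorentzSpace d)
      (Fin.snoc (α := fun _ => ℝ) (fun i => v i) 1) = inner ℝ u v - 1 := by
    intro u v
    simp [lorentzProd, inner_eq_sum]
  rw [lorentzVec_lightBall hu, lorentzVec_lightBall hv, lorentzProd_smul_left,
    lorentzProd_smul_right, e, h.inner_sub_one]
  have hu' := (sqrt_pos_of_outer hu).ne'
  have hv' := (sqrt_pos_of_outer hv).ne'
  field_simp

/-! ## Curvatures along a flag -/

theorem lorentzCurvature_eq_of_vertices {d m : ℕ} {F : Set (Euc (d + 1))}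
    {v : Fin (m + 1) → Euc (d + 1)} (hv : Function.Injective v) {i : Fin (m + 1)}
    (hF : vertices F = v '' {j | j ≤ i}) :
    lorentzCurvature F = ((i : ℕ) + 1 : ℝ)⁻¹ * ∑ j with j ≤ i, (lightBall (v j)).curvature := by
  have hset : {j | j ≤ i} = ((Finset.univ.filter fun j => j ≤ i : Finset (Fin (m + 1))) :
      Set (Fin (m + 1))) := by ext; simp
  have hcard : (vertices F).ncard = (i : ℕ) + 1 := by
    rw [hF, Set.ncard_image_of_injective _ hv, hset, Set.ncard_coe_finset]
    have : (Finset.univ.filter fun j => j ≤ i) = Finset.Iic i := by ext; simp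
    rw [this, Fin.card_Iic]
  rw [lorentzCurvature, lorentzBarycenter, vecCurvature_smul, hcard, hF,
    finsum_mem_image hv.injOn, hset, finsum_mem_coe_finset, vecCurvature_sum]
  simp only [vecCurvature_lorentzVec]
  push_cast
  rfl

/-- The sum of squared deviations from the mean, computed from the running averages. -/
theorem sum_choose_mul_sq_sub_average (k : ℕ → ℝ) (n : ℕ) :
    ∑ i ∈ Finset.range n, ((i + 2).choose 2 : ℝ) *
      (((i : ℝ) + 1)⁻¹ * ∑ j ∈ Finset.range (i + 1), k j -
        ((i : ℝ) + 1 + 1)⁻¹ * ∑ j ∈ Finset.range (i + 1 + 1), k j) ^ 2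
      = (∑ j ∈ Finset.range (n + 1), k j ^ 2
          - (∑ j ∈ Finset.range (n + 1), k j) ^ 2 / (n + 1)) / 2 := by
  induction n with
  | zero => simp
  | succ n ih =>
    -- With `A` the sum of the first `n + 1` terms and `x` the next one, the increment of the
    -- average is `(A - (n+1)x) / ((n+1)(n+2))` up to sign; the binomial weight cancels one factor
    -- `(n+1)(n+2)`, leaving `1/2`.
    rw [Finset.sum_range_succ, ih, Finset.sum_range_succ _ (n + 1), Finset.sum_range_succ _ (n + 1),
      Nat.cast_choose_two]
    push_cast
    set A := ∑ j ∈ Finset.range (n + 1), k j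
    have h1 : (n : ℝ) + 1 ≠ 0 := by positivity
    have h2 : (n : ℝ) + 1 + 1 ≠ 0 := by positivity
    field_simp
    ring

theorem sum_choose_mul_sq_sub_average_fin (n : ℕ) (k : Fin (n + 1) → ℝ) :
    ∑ i : Fin n, (((i : ℕ) + 2).choose 2 : ℝ) *
      ((((i.castSucc : Fin (n + 1)) : ℕ) + 1 : ℝ)⁻¹ * (∑ j with j ≤ i.castSucc, k j) -
        (((i.succ : Fin (n + 1)) : ℕ) + 1 : ℝ)⁻¹ * ∑ j with j ≤ i.succ, k j) ^ 2
      = (∑ j, k j ^ 2 - (∑ j, k j) ^ 2 / (n + 1)) / 2 := by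
  -- The value `0` beyond `n` never enters, as all the sums stop at index `n`.
  let K : ℕ → ℝ := fun m => if h : m < n + 1 then k ⟨m, h⟩ else 0
  have hK : ∀ j : Fin (n + 1), k j = K j := by
    intro j
    simp only [K]
    rw [dif_pos j.isLt]
  have hpart : ∀ i : Fin (n + 1), ∑ j with j ≤ i, k j = ∑ j ∈ Finset.range ((i : ℕ) + 1), K j := by
    intro i
    simp only [hK]
    refine Finset.sum_bij (fun j _ => (j : ℕ)) ?_ ?_ ?_ ?_
    · intro j hj
      simpa [Nat.lt_succ_iff] using hj
    · intro _ _ _ _ h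
      exact Fin.ext h
    · intro m hm
      have := Finset.mem_range.1 hm
      have hmi : m ≤ i := Nat.lt_succ_iff.1 this
      have hmn : m < n + 1 := this.trans_le i.isLt
      refine ⟨⟨m, hmn⟩, Finset.mem_filter.2 ⟨Finset.mem_univ _, hmi⟩, rfl⟩
    · intro _ _
      rfl
  simp only [hpart]
  simp only [hK, Fin.val_castSucc, Fin.val_succ]
  rw [Fin.sum_univ_eq_sum_range (fun j => K j ^ 2), Fin.sum_univ_eq_sum_range K,
    ← sum_choose_mul_sq_sub_average, Finset.sum_range]
  push_cast
  rfl

end PolytopalBalls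
end

open PolytopalBalls
theorem corollary4p5 (d : ℕ) (hd : 1 ≤ d) :
    (∀ (T : Set (Euc (d + 1))) (f : Fin (d + 2) → Set (Euc (d + 1))),
      IsSimplex T → IsEdgeScribed T → IsFlag T f →
        -- every vertex is outer-sphere, so that the curvatures below are those of actual balls
        (∀ v ∈ vertices T, 1 < ‖v‖) ∧
        lorentzCurvature T ^ 2 = (d : ℝ) / ((d : ℝ) + 2) *
          ∑ i : Fin (d + 1), (((i : ℕ) + 2).choose 2 : ℝ) *
            (lorentzCurvature (f i.castSucc) - lorentzCurvature (f i.succ)) ^ 2 ∧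
        -- vertex averages along the flag, and the result of substituting them
        ∃ v : Fin (d + 2) → Euc (d + 1), Function.Injective v ∧
          (∀ i, vertices (f i) = v '' {j | j ≤ i}) ∧
          (∀ i, lorentzCurvature (f i) =
            ((i : ℕ) + 1 : ℝ)⁻¹ * ∑ j with j ≤ i, (lightBall (v j)).curvature) ∧
          (∑ j, (lightBall (v j)).curvature) ^ 2 =
            (d : ℝ) * ∑ j, (lightBall (v j)).curvature ^ 2) ∧
    -- the Soddy-Gosset theorem
    (∀ b : Fin (d + 2) → Ball d, (∀ i j, i ≠ j → (b i).Tangent (b j)) →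
      (∑ i, (b i).curvature) ^ 2 = (d : ℝ) * ∑ i, (b i).curvature ^ 2) := by
  refine ⟨fun T f hT hE hf => ?_, fun b hb => ?_⟩
  · obtain ⟨b, rfl⟩ := hT.exists_affineBasis
    obtain ⟨σ, hσ, hv⟩ := hf.exists_vertex_enumeration
    have hinj : Function.Injective (b ∘ σ) := b.ind.injective.comp hσ
    have hcurv := fun i => lorentzCurvature_eq_of_vertices hinj (hv i)
    have hdesc : (∑ j, (lightBall ((b ∘ σ) j)).curvature) ^ 2 =
        (d : ℝ) * ∑ j, (lightBall ((b ∘ σ) j)).curvature ^ 2 := by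
      simp only [← vecCurvature_lorentzVec]
      refine sq_sum_vecCurvature hd _ (fun i => Ball.lorentzProd_self _) fun i j hij => ?_
      exact lorentzProd_lightBall (hE.one_lt_norm _) (hE.one_lt_norm _)
        (hE.isTangentToUnitSphere (hσ.ne hij))
    refine ⟨?_, ?_, b ∘ σ, hinj, hv, hcurv, hdesc⟩
    · rw [vertices_convexHull_range]
      rintro _ ⟨i, rfl⟩
      exact hE.one_lt_norm i
    · have hT := hcurv (Fin.last (d + 1))
      rw [hf.last_eq] at hT
      simp only [Fin.le_last, Finset.filter_true, Fin.val_last] at hT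
      simp only [hcurv]
      rw [sum_choose_mul_sq_sub_average_fin, hT]
      set K := ∑ j, (lightBall ((b ∘ σ) j)).curvature
      set Q := ∑ j, (lightBall ((b ∘ σ) j)).curvature ^ 2
      have hd0 : (d : ℝ) ≠ 0 := by positivity
      have hd2 : (d : ℝ) + 2 ≠ 0 := by positivity
      -- Then `Q - K² / (d+2) = 2K² / (d(d+2))`; half of it, times `d / (d+2)`, is `(K / (d+2))²`.
      have hQ : Q = K ^ 2 / d := by rw [hdesc]; field_simp
      rw [hQ]
      push_cast
      have hd3 : (d : ℝ) + 1 + 1 ≠ 0 := by positivity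
      field_simp
      ring
  · simp only [← vecCurvature_lorentzVec]
    exact sq_sum_vecCurvature hd _ (fun i => (b i).lorentzProd_self)
      fun i j hij => (hb i j hij).lorentzProd_eq hd
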